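/- Let $K$ be a field, let $S=K[x_1,\ldots,x_n]$, and let $J\subsetneq I$ be monomial ideals of $S$. Denote by $G(I)$ and $G(J)$ the sets of minimal monomial generators of $I$ and $J$. The lcm number $l(I/J)$ is the maximal integer $t$ for which there exist monomials $u_1,\ldots,u_t\in G(I)\cup G(J)$ such that $$u_1\neq \operatorname{lcm}(u_1,u_2)\neq\cdots\neq\operatorname{lcm}(u_1,u_2,\ldots,u_t),$$ i.e. any two consecutive terms of this sequence are different. Let $\operatorname{depth}(I/J)$ be the maximal length of an $I/J$-regular sequence in the ideal $(x_1,\ldots,x_n)$. A Stanley decomposition of the $\mathbb{Z}^n$-graded $S$-module $I/J$ is a decomposition $I/J=\bigoplus_{i=1}^m u_iK[Z_i]$ into finitely many $K$-subspaces, where $u_i\in I/J$ is homogeneous, $Z_i\subseteq\{x_1,\ldots,x_n\}$, and $u_iK[Z_i]=\{u_iv : v\in K[Z_i]\}$ is a free $K[Z_i]$-module with basis $u_i$. Its Stanley depth is $\min_i|Z_i|$, and $\operatorname{sdepth}(I/J)$ is the maximum of the Stanley depths of all Stanley decompositions of $I/J$. Then $$\operatorname{depth}(I/J)\geq n-l(I/J)+1\qquad\text{and}\qquad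 \operatorname{sdepth}(I/J)\geq n-l(I/J)+1 .$$ -/

import Mathlib

namespace MonomialLcm

open MvPolynomial

/-! Monomials of `K[x_i : i ∈ σ]` are identified with their exponent vectors `a : σ →₀ ℕ`:
divisibility is the pointwise order and the least common multiple is the supremum `⊔`. -/

section Ideals

variable {σ K : Type*} [Field K]

/-- A monomial ideal: an ideal generated by a set of monomials. -/
def IsMonomialIdeal (I : Ideal (MvPolynomial σ K)) : Prop :=
  ∃ A : Set (σ →₀ ℕ), I = Ideal.span ((fun a => monomial a (1 : K)) '' A)

/-- `G(I)`: (exponent vectors of) the minimal monomial generators of a monomial ideal `I`, that is,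
the monomials of `I` which are minimal with respect to divisibility. -/
def minGens (I : Ideal (MvPolynomial σ K)) : Set (σ →₀ ℕ) :=
  {a | Minimal (fun b => monomial b (1 : K) ∈ I) a}

/-- There are `u_1, …, u_t ∈ A` (here `u 0, …, u (t - 1)`) with
`u_1 ≠ lcm(u_1, u_2) ≠ ⋯ ≠ lcm(u_1, …, u_t)`. -/
def HasLcmChain (A : Set (σ →₀ ℕ)) (t : ℕ) : Prop :=
  ∃ u : ℕ → σ →₀ ℕ, (∀ k < t, u k ∈ A) ∧
    ∀ k, k + 1 < t → (Finset.range (k + 1)).sup u ≠ (Finset.range (k + 2)).sup u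

/-- The lcm number `l(I/J)`: the maximal `t` for which there is a chain
`u_1 ≠ lcm(u_1, u_2) ≠ ⋯ ≠ lcm(u_1, …, u_t)` with all `u_i ∈ G(I) ∪ G(J)`. (For finitely many
variables the maximum exists, see `bddAbove_hasLcmChain` below.) -/
noncomputable def lcmNumber (I J : Ideal (MvPolynomial σ K)) : ℕ :=
  sSup {t : ℕ | HasLcmChain (minGens I ∪ minGens J) t}

/-- A monomial ideal is generated by the monomials in `minGens I`. -/
theorem span_minGens {I : Ideal (MvPolynomial σ K)} (hI : IsMonomialIdeal I) :
    Ideal.span ((fun a => monomial a (1 : K)) '' minGens I) = I := by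
  apply le_antisymm
  · rw [Ideal.span_le]
    rintro _ ⟨a, ha, rfl⟩
    exact ha.1
  · obtain ⟨A, rfl⟩ := hI
    rw [Ideal.span_le]
    rintro _ ⟨a, ha, rfl⟩
    have hmem : monomial a (1 : K) ∈ Ideal.span ((fun a => monomial a (1 : K)) '' A) :=
      Ideal.subset_span ⟨a, ha, rfl⟩
    obtain ⟨b, hba, hb⟩ := exists_minimal_le_of_wellFoundedLT
      (fun b => monomial b (1 : K) ∈ Ideal.span ((fun a => monomial a (1 : K)) '' A)) a hmem
    have h : monomial a (1 : K) = monomial (a - b) 1 * monomial b 1 := by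
      rw [monomial_mul, tsub_add_cancel_of_le hba, one_mul]
    change monomial a (1 : K) ∈ _
    rw [h]
    exact Ideal.mul_mem_left _ _ (Ideal.subset_span ⟨b, hb, rfl⟩)

theorem finite_minGens [Finite σ] (I : Ideal (MvPolynomial σ K)) : (minGens I).Finite :=
  WellQuasiOrderedLE.finite_of_isAntichain
    (setOfPred_minimal_antichain fun b => monomial b (1 : K) ∈ I)

/-- The set whose supremum is the lcm number is bounded, and it contains `0`. -/
theorem bddAbove_hasLcmChain [Finite σ] (I J : Ideal (MvPolynomial σ K)) :
    BddAbove {t : ℕ | HasLcmChain (minGens I ∪ minGens J) t} := by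
  have hfin : (minGens I ∪ minGens J).Finite := (finite_minGens I).union (finite_minGens J)
  refine ⟨hfin.toFinset.card, ?_⟩
  rintro t ⟨u, hu, hne⟩
  have hinj : Set.InjOn u (Finset.range t : Set ℕ) := by
    have key : ∀ i j, i < j → j < t → u i ≠ u j := by
      intro i j hij hj heq
      obtain ⟨k, rfl⟩ : ∃ k, j = k + 1 := ⟨j - 1, by omega⟩
      apply hne k hj
      rw [Finset.range_add_one (n := k + 1), Finset.sup_insert, ← heq]
      exact (sup_eq_right.2 (Finset.le_sup (f := u) (Finset.mem_range.2 hij))).symm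
    intro i hi j hj heq
    simp only [Finset.coe_range, Set.mem_Iio] at hi hj
    rcases lt_trichotomy i j with h | h | h
    · exact (key i j h hj heq).elim
    · exact h
    · exact (key j i h hi heq.symm).elim
  have := Finset.card_le_card_of_injOn (s := Finset.range t) (t := hfin.toFinset) u
    (fun k hk => by simpa using hu k (by simpa using hk)) hinj
  simpa using this

end Ideals

section Modules

variable {σ K : Type*} [Field K]

/-- The depth of a module `M` over `S = K[x_i : i ∈ σ]` (with respect to the graded maximal ideal
`(x_i : i ∈ σ)`): the supremum of the lengths of the `M`-regular sequences in this ideal. -/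
noncomputable def depth (M : Type*) [AddCommGroup M] [Module (MvPolynomial σ K) M] : ℕ∞ :=
  ⨆ rs ∈ {rs : List (MvPolynomial σ K) | RingTheory.Sequence.IsRegular M rs ∧
    ∀ r ∈ rs, r ∈ Ideal.span (Set.range (X : σ → MvPolynomial σ K))}, (rs.length : ℕ∞)

variable {M : Type*} [AddCommGroup M] [Module K M] [Module (MvPolynomial σ K) M]
  [IsScalarTower K (MvPolynomial σ K) M]

/-- The `K`-subspace `u K[Z] = {v • u | v ∈ K[Z]}` of `M`. -/
noncomputable def stanleySpace (u : M) (Z : Finset σ) : Submodule K M :=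
  (Subalgebra.toSubmodule (supported K (Z : Set σ))).map
    ((LinearMap.toSpanSingleton (MvPolynomial σ K) M u).restrictScalars K)

/-- A Stanley decomposition of a module `M` whose multigrading is given by the `K`-subspaces
`ℳ a`: a finite family of homogeneous elements `u_i` and sets of variables `Z_i` such that
each `u_i K[Z_i]` is free over `K[Z_i]` (with basis `u_i`), and `M` is the direct sum
of the subspaces `u_i K[Z_i]`. -/
structure StanleyDecomposition {ι : Type*} (ℳ : ι → Submodule K M) where
  /-- the number of Stanley spaces -/
  size : ℕ
  /-- the generators of the Stanley spaces -/
  u : Fin size → M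
  /-- the sets of variables of the Stanley spaces -/
  Z : Fin size → Finset σ
  homogeneous : ∀ i, ∃ a, u i ∈ ℳ a
  free : ∀ i, ∀ v ∈ supported K (Z i : Set σ), v • u i = 0 → v = 0
  isInternal : DirectSum.IsInternal fun i => stanleySpace (K := K) (u i) (Z i)

/-- The Stanley depth of a decomposition: the minimal dimension `|Z_i|` of its Stanley spaces. -/
noncomputable def StanleyDecomposition.sdepth {ι : Type*} {ℳ : ι → Submodule K M}
    (D : StanleyDecomposition (σ := σ) ℳ) : ℕ∞ :=
  ⨅ i, ((D.Z i).card : ℕ∞)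

variable (σ) in
/-- The Stanley depth of a multigraded module: the maximum of the Stanley depths of its Stanley
decompositions. -/
noncomputable def sdepth {ι : Type*} (ℳ : ι → Submodule K M) : ℕ∞ :=
  ⨆ D : StanleyDecomposition (σ := σ) ℳ, D.sdepth

end Modules

section Quotient

variable {σ K : Type*} [Field K]

/-- The `S`-module `I/J` for ideals `J ⊆ I` of `S`. -/
abbrev IdealQuot (I J : Ideal (MvPolynomial σ K)) : Type _ :=
  I ⧸ Submodule.submoduleOf J I

/-- The component of `I/J` of multidegree `a`: the classes of the elements `c x^a` of `I` with
`c ∈ K`. (The components of `I/J` in degrees outside `ℕ^n` vanish.) -/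
noncomputable def multigrading (I J : Ideal (MvPolynomial σ K)) (a : σ →₀ ℕ) :
    Submodule K (IdealQuot I J) :=
  ((Submodule.span K {monomial a (1 : K)}).comap
      ((Submodule.subtype I).restrictScalars K)).map
    ((Submodule.mkQ (Submodule.submoduleOf J I)).restrictScalars K)

end Quotient

end MonomialLcm

/-!
Write monomials as exponent vectors; a monomial ideal is then an upper set of `ℕ^n`. Both bounds
come from one filtration of `I/J` by monomial ideals `J = L_0 ⊂ L_1 ⊂ ⋯ ⊂ L_m = I` whose successive
quotients are isomorphic, up to a shift by a monomial `u_k`, to polynomial rings `K[Z_k]` with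
`|Z_k| ≥ r := n + 1 - l(I/J)`. In exponents, `L_{k+1}` is obtained from `L_k` by adjoining a disjoint
cone `u_k + ℕ^{Z_k}` (`ConeFiltration`).

Such a filtration is found by induction on `n` (`exists_coneFiltration`). Let `d` be the largest
exponent of the first variable in the given generators, and slice both upper sets at the exponent
`j` of this variable. From `j = d` on the slices are constant, so the cones of the slice at `d` gain
the first variable as a direction (`ConeFiltration.stable_slice`). For `j < d` the generators of
the slice come from generators with exponent at most `j`; a chain of lcms among them can be
prolonged by a generator of exponent `d` (`HasLcmChain.succ_of_tail`), so the bound on the length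
of chains drops by one, which compensates for the lost variable.

For the Stanley depth, the cones of the filtration are the Stanley spaces of a decomposition
(`ConeFiltration.le_sdepth`). For the depth, the first `r` elementary symmetric polynomials are a
weakly regular sequence on `K[Z]` for every `Z` with `|Z| ≥ r` simultaneously
(`isWeaklyRegular_coordinatePrime`), and weak regularity of a fixed sequence passes to extensions
(`isWeaklyRegular_of_exact`), hence to `I/J`. No assumption on the size of `K` is needed for this
choice of sequence. That the sequence is regular is Nakayama's lemma for monomial ideals
(`top_ne_smul_top`).
-/

namespace MonomialLcm

open MvPolynomial

/-! ### Cone filtrations of upper sets -/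

section Filtration

/-- The exponents of the monomials in `x^u K[Z]`. -/
def cone {σ : Type*} (u : σ →₀ ℕ) (Z : Finset σ) : Set (σ →₀ ℕ) :=
  {b | u ≤ b ∧ ∀ i ∉ Z, b i = u i}

/-- `V` arises from `U` by successively adjoining disjoint cones with at least `r` directions, such
that every intermediate set is an upper set. -/
inductive ConeFiltration {σ : Type*} (r : ℕ) (U : Set (σ →₀ ℕ)) : Set (σ →₀ ℕ) → Prop
  | refl : ConeFiltration r U U
  | step {V V' : Set (σ →₀ ℕ)} (u : σ →₀ ℕ) (Z : Finset σ) :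
      ConeFiltration r U V → r ≤ Z.card → Disjoint V (cone u Z) → V' = V ∪ cone u Z →
      IsUpperSet V' → ConeFiltration r U V'

theorem ConeFiltration.trans {σ : Type*} {r : ℕ} {U V W : Set (σ →₀ ℕ)}
    (h₁ : ConeFiltration r U V) (h₂ : ConeFiltration r V W) : ConeFiltration r U W := by
  induction h₂ with
  | refl => exact h₁
  | step u Z _ hr hd he hup ih => exact .step u Z ih hr hd he hup

theorem ConeFiltration.subset {σ : Type*} {r : ℕ} {U V : Set (σ →₀ ℕ)}
    (h : ConeFiltration r U V) : U ⊆ V := by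
  induction h with
  | refl => exact subset_rfl
  | step u Z _ _ _ he _ ih => exact he ▸ ih.trans Set.subset_union_left

theorem ConeFiltration.isUpperSet {σ : Type*} {r : ℕ} {U V : Set (σ →₀ ℕ)}
    (h : ConeFiltration r U V) (hU : IsUpperSet U) : IsUpperSet V := by
  cases h with
  | refl => exact hU
  | step _ _ _ _ _ _ hup => exact hup

theorem finset_sup_finsupp_apply {ι σ : Type*} (s : Finset ι) (u : ι → σ →₀ ℕ) (i : σ) :
    (s.sup u) i = s.sup fun k => u k i := by
  classical
  induction s using Finset.induction_on with
  | empty => rfl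
  | insert a s _ ih => simp [Finset.sup_insert, ih]

theorem tail_mono {n : ℕ} {a b : Fin (n + 1) →₀ ℕ} (h : a ≤ b) : a.tail ≤ b.tail :=
  fun i => h i.succ

theorem le_of_tail_le {n : ℕ} {a b : Fin (n + 1) →₀ ℕ} (h0 : a 0 ≤ b 0) (h : a.tail ≤ b.tail) :
    a ≤ b := by
  intro i
  refine Fin.cases h0 (fun i => h i) i

/-- A chain among the tails of a set of exponents lifts to a chain of exponents. -/
theorem HasLcmChain.of_image_tail {n t : ℕ} {A : Set (Fin (n + 1) →₀ ℕ)}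
    (h : HasLcmChain (Finsupp.tail '' A) t) : HasLcmChain A t := by
  obtain ⟨v, hv, hne⟩ := h
  choose! u hu huv using hv
  refine ⟨u, hu, fun k hk heq => hne k hk ?_⟩
  have key : ∀ m ≤ t, (Finset.range m).sup v = Finsupp.tail ((Finset.range m).sup u) := by
    intro m hm
    ext i
    rw [finset_sup_finsupp_apply, Finsupp.tail_apply, finset_sup_finsupp_apply]
    refine Finset.sup_congr rfl fun k hk => ?_
    rw [← huv k (by have := Finset.mem_range.1 hk; omega), Finsupp.tail_apply]
  rw [key _ (by omega), key _ (by omega), heq]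

theorem HasLcmChain.mono {σ : Type*} {t : ℕ} {A B : Set (σ →₀ ℕ)} (hBA : B ⊆ A)
    (h : HasLcmChain B t) : HasLcmChain A t := by
  obtain ⟨u, hu, hne⟩ := h
  exact ⟨u, fun k hk => hBA (hu k hk), hne⟩

/-- A chain of exponents with bounded first coordinate is prolonged by any exponent exceeding this
bound. -/
theorem HasLcmChain.succ_of_tail {n t j : ℕ} {A : Set (Fin (n + 1) →₀ ℕ)}
    {g : Fin (n + 1) →₀ ℕ} (hg : g ∈ A) (hj : j < g 0)
    (h : HasLcmChain (Finsupp.tail '' {a ∈ A | a 0 ≤ j}) t) : HasLcmChain A (t + 1) := by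
  obtain ⟨u, hu, hne⟩ := h.of_image_tail
  have hsup : ∀ m ≤ t, (Finset.range m).sup (fun k => if k < t then u k else g)
      = (Finset.range m).sup u := fun m hm =>
    Finset.sup_congr rfl fun k hk => if_pos (by have := Finset.mem_range.1 hk; omega)
  refine ⟨fun k => if k < t then u k else g, fun k _ => ?_, fun k hk => ?_⟩
  · dsimp only
    split_ifs with hkt
    exacts [(hu k hkt).1, hg]
  · rcases Nat.lt_or_ge (k + 1) t with hkt | hkt
    · rw [hsup _ (by omega), hsup _ (by omega)]
      exact hne k hkt
    · obtain rfl : t = k + 1 := by omega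
      intro heq
      rw [hsup _ le_rfl, Finset.range_add_one (n := k + 1), Finset.sup_insert,
        if_neg (lt_irrefl _)] at heq
      have h1 : g 0 ≤ ((Finset.range (k + 1)).sup u) 0 := by
        rw [heq]
        exact (le_sup_left : g ≤ _) 0
      have h2 : ((Finset.range (k + 1)).sup u) 0 ≤ j := by
        rw [finset_sup_finsupp_apply]
        exact Finset.sup_le fun m hm => (hu m (Finset.mem_range.1 hm)).2
      omega

theorem cons_tail_of_eq {n j : ℕ} {a : Fin (n + 1) →₀ ℕ} (h : a 0 = j) :
    Finsupp.cons j a.tail = a := by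
  rw [← h, Finsupp.cons_tail]

theorem mem_cone_cons {n j : ℕ} {u : Fin n →₀ ℕ} {Z : Finset (Fin n)} {a : Fin (n + 1) →₀ ℕ} :
    a ∈ cone (Finsupp.cons j u) (Z.map (Fin.succEmb n)) ↔ a 0 = j ∧ a.tail ∈ cone u Z := by
  constructor
  · rintro ⟨hle, heq⟩
    refine ⟨by simpa using heq 0 (by simp),
      fun i => by simpa [Finsupp.tail_apply] using hle i.succ, fun i hi => ?_⟩
    simpa [Finsupp.tail_apply] using heq i.succ (by simpa using hi)
  · rintro ⟨h0, hle, heq⟩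
    refine ⟨le_of_tail_le (by simp [h0]) (by simpa using hle), fun i => ?_⟩
    refine Fin.cases (fun _ => by simpa using h0) (fun i hi => ?_) i
    simpa [Finsupp.tail_apply] using heq i (by simpa using hi)

theorem mem_cone_cons_insert {n j : ℕ} {u : Fin n →₀ ℕ} {Z : Finset (Fin n)}
    {a : Fin (n + 1) →₀ ℕ} :
    a ∈ cone (Finsupp.cons j u) (insert 0 (Z.map (Fin.succEmb n))) ↔
      j ≤ a 0 ∧ a.tail ∈ cone u Z := by
  constructor
  · rintro ⟨hle, heq⟩
    refine ⟨by simpa using hle 0,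
      fun i => by simpa [Finsupp.tail_apply] using hle i.succ, fun i hi => ?_⟩
    simpa [Finsupp.tail_apply] using heq i.succ (by simpa using hi)
  · rintro ⟨h0, hle, heq⟩
    refine ⟨le_of_tail_le (by simpa using h0) (by simpa using hle), fun i => ?_⟩
    refine Fin.cases (fun h => (h (by simp)).elim) (fun i hi => ?_) i
    simpa [Finsupp.tail_apply] using heq i (by simpa using hi)

/-- A cone filtration between the slices of `U ⊆ V` at first coordinate `j` is a cone
filtration of the part of `V` with first coordinate at least `j` over the part with larger first
coordinate. -/
theorem ConeFiltration.slice {n r : ℕ} {U V : Set (Fin (n + 1) →₀ ℕ)} {j : ℕ}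
    (hU : IsUpperSet U) (hV : IsUpperSet V)
    {W : Set (Fin n →₀ ℕ)} (hWV : ∀ a ∈ W, Finsupp.cons j a ∈ V)
    (h : ConeFiltration r {a | Finsupp.cons j a ∈ U} W) :
    ConeFiltration r (U ∪ {a ∈ V | j + 1 ≤ a 0})
      (U ∪ {a ∈ V | j + 1 ≤ a 0} ∪ {a | a 0 = j ∧ a.tail ∈ W}) := by
  have hUj : IsUpperSet {a : Fin n →₀ ℕ | Finsupp.cons j a ∈ U} := fun a b hab ha =>
    hU (le_of_tail_le (by simp) (by simpa using hab)) ha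
  induction h with
  | refl =>
    convert ConeFiltration.refl (r := r) using 1
    refine Set.union_eq_left.2 fun a ha => Or.inl ?_
    have := ha.2
    rwa [Set.mem_ofPred_eq, cons_tail_of_eq ha.1] at this
  | @step W W' u Z hf hr hd he hup ih =>
    refine .step (Finsupp.cons j u) (Z.map (Fin.succEmb n))
      (ih fun a ha => hWV a (he ▸ Or.inl ha)) (by simpa using hr) ?_ ?_ ?_
    · rw [Set.disjoint_left]
      rintro a ha hc
      obtain ⟨h0, hc⟩ := mem_cone_cons.1 hc
      refine Set.disjoint_left.1 hd ?_ hc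
      rcases ha with (ha | ha) | ha
      · refine hf.subset ?_
        rwa [Set.mem_ofPred_eq, cons_tail_of_eq h0]
      · have := ha.2
        omega
      · exact ha.2
    · ext a
      simp only [Set.mem_union, he, mem_cone_cons, Set.mem_ofPred_eq]
      tauto
    · rintro a b hab ((ha | ha) | ha)
      · exact Or.inl (Or.inl (hU hab ha))
      · exact Or.inl (Or.inr ⟨hV hab ha.1, ha.2.trans (hab 0)⟩)
      · rcases (hab 0).lt_or_eq with hlt | heq
        · refine Or.inl (Or.inr ⟨hV hab ?_, ha.1 ▸ hlt⟩)
          have := hWV _ ha.2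
          rwa [cons_tail_of_eq ha.1] at this
        · exact Or.inr ⟨heq ▸ ha.1, hup (tail_mono hab) ha.2⟩

/-- Where the slices of `U` no longer depend on the first coordinate, a cone filtration of slices
extends to all larger first coordinates, with one more direction in each cone. -/
theorem ConeFiltration.stable_slice {n r : ℕ} {U : Set (Fin (n + 1) →₀ ℕ)} {d : ℕ}
    (hU : IsUpperSet U) (hstab : ∀ a ∈ U, d ≤ a 0 → Finsupp.cons d a.tail ∈ U)
    {W : Set (Fin n →₀ ℕ)} (h : ConeFiltration (r - 1) {a | Finsupp.cons d a ∈ U} W) :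
    ConeFiltration r U (U ∪ {a | d ≤ a 0 ∧ a.tail ∈ W}) := by
  induction h with
  | refl =>
    convert ConeFiltration.refl (r := r) using 1
    exact Set.union_eq_left.2 fun a ha => hU (le_of_tail_le (by simpa using ha.1) (by simp)) ha.2
  | @step W W' u Z hf hr hd he hup ih =>
    refine .step (Finsupp.cons d u) (insert 0 (Z.map (Fin.succEmb n))) ih ?_ ?_ ?_ ?_
    · rw [Finset.card_insert_of_notMem (by simp), Finset.card_map]
      omega
    · rw [Set.disjoint_left]
      rintro a ha hc
      obtain ⟨h0, hc⟩ := mem_cone_cons_insert.1 hc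
      refine Set.disjoint_left.1 hd ?_ hc
      rcases ha with ha | ha
      · exact hf.subset (hstab a ha h0)
      · exact ha.2
    · ext a
      simp only [Set.mem_union, he, mem_cone_cons_insert, Set.mem_ofPred_eq]
      tauto
    · exact hU.union fun a b hab ha => ⟨ha.1.trans (hab 0), hup (tail_mono hab) ha.2⟩

theorem cons_mem_upperClosure {n j : ℕ} {A : Set (Fin (n + 1) →₀ ℕ)} {b : Fin n →₀ ℕ} :
    Finsupp.cons j b ∈ upperClosure A ↔
      b ∈ upperClosure (Finsupp.tail '' {a ∈ A | a 0 ≤ j}) := by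
  simp only [mem_upperClosure, Set.exists_mem_image, Set.mem_ofPred_eq]
  constructor
  · rintro ⟨a, ha, hab⟩
    exact ⟨a, ⟨ha, by simpa using hab 0⟩, by simpa using tail_mono hab⟩
  · rintro ⟨a, ⟨ha, h0⟩, hab⟩
    exact ⟨a, ha, le_of_tail_le (by simpa using h0) (by simpa using hab)⟩

/-- If the lcm chains in generating sets of two upper sets `U ⊆ V` have length at most `n + 1 - r`,
then `V` has a cone filtration over `U` with cones of dimension at least `r`. The slices
at a first coordinate below the maximum `d` occurring in the generators admit only shorter
chains, as a generator attaining `d` prolongs them.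

The subtraction in `hr` is truncated, so that the hypothesis is void for `r = 0`; this is needed for
the slice at `d`, to which the induction hypothesis is applied with `r - 1`. The generating sets
need not be minimal, since those of the slices are not. -/
theorem exists_coneFiltration {n : ℕ} {r : ℕ} {A B : Set (Fin n →₀ ℕ)} (hA : A.Finite)
    (hB : B.Finite) (hsub : upperClosure B ≤ upperClosure A)
    (hr : ∀ t, HasLcmChain (A ∪ B) t → r ≤ n + 1 - t) :
    ConeFiltration r (upperClosure A : Set (Fin n →₀ ℕ)) (upperClosure B) := by
  have hsub' : (upperClosure A : Set (Fin n →₀ ℕ)) ⊆ upperClosure B := hsub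
  induction n generalizing r with
  | zero =>
    by_cases h : (upperClosure A : Set (Fin 0 →₀ ℕ)) = upperClosure B
    · rw [← h]; exact .refl
    · obtain ⟨b, hb, hbA⟩ := Set.exists_of_ssubset (hsub'.ssubset_of_ne h)
      obtain ⟨a, ha, -⟩ := mem_upperClosure.1 hb
      -- A single generator is a chain of length `1`, which forces `r = 0`.
      have h1 := hr 1 ⟨fun _ => a, fun _ _ => Or.inr ha, fun k hk => by omega⟩
      have hall : ∀ c : Fin 0 →₀ ℕ, c = b := fun c => Subsingleton.elim _ _
      refine .step b ∅ .refl (by simpa using h1) ?_ ?_ (upperClosure B).upper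
      · rw [Set.disjoint_left]
        intro c hc
        exact (hbA (hall c ▸ hc)).elim
      · ext c
        obtain rfl := hall c
        simp only [Set.mem_union, hb, true_iff]
        exact Or.inr ⟨le_rfl, fun _ _ => rfl⟩
  | succ n ih =>
    have hfin := hA.union hB
    obtain ⟨d, hd, hdmax⟩ : ∃ d, (∀ a ∈ A ∪ B, a 0 ≤ d) ∧ ∀ j < d, ∃ g ∈ A ∪ B, j < g 0 := by
      refine ⟨hfin.toFinset.sup fun a => a 0, fun a ha => ?_, fun j hj => ?_⟩
      · exact Finset.le_sup (f := fun a : Fin (n + 1) →₀ ℕ => a 0) (hfin.mem_toFinset.2 ha)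
      · obtain ⟨g, hg, hjg⟩ := Finset.lt_sup_iff.1 hj
        exact ⟨g, hfin.mem_toFinset.1 hg, hjg⟩
    have hslice : ∀ (C : Set (Fin (n + 1) →₀ ℕ)) (j : ℕ),
        {a : Fin n →₀ ℕ | Finsupp.cons j a ∈ (upperClosure C : Set (Fin (n + 1) →₀ ℕ))}
          = upperClosure (Finsupp.tail '' {a ∈ C | a 0 ≤ j}) := fun C j =>
      Set.ext fun b => cons_mem_upperClosure
    have hstab : ∀ C ⊆ A ∪ B, ∀ a ∈ (upperClosure C : Set (Fin (n + 1) →₀ ℕ)), d ≤ a 0 →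
        Finsupp.cons d a.tail ∈ (upperClosure C : Set (Fin (n + 1) →₀ ℕ)) := by
      intro C hC a ha _
      obtain ⟨c, hc, hca⟩ := mem_upperClosure.1 ha
      exact mem_upperClosure.2 ⟨c, hc, le_of_tail_le (by simpa using hd c (hC hc))
        (by simpa using tail_mono hca)⟩
    have hslices : ∀ j r', (∀ t, HasLcmChain (Finsupp.tail '' {a ∈ A ∪ B | a 0 ≤ j}) t →
        r' ≤ n + 1 - t) →
        ConeFiltration r' {a | Finsupp.cons j a ∈ (upperClosure A : Set (Fin (n + 1) →₀ ℕ))}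
          {a | Finsupp.cons j a ∈ (upperClosure B : Set (Fin (n + 1) →₀ ℕ))} := by
      intro j r' hr'
      have hs : ∀ b : Fin n →₀ ℕ, b ∈ upperClosure (Finsupp.tail '' {a ∈ A | a 0 ≤ j}) →
          b ∈ upperClosure (Finsupp.tail '' {a ∈ B | a 0 ≤ j}) := fun b hb =>
        cons_mem_upperClosure.1 (hsub' (cons_mem_upperClosure.2 hb))
      rw [hslice, hslice]
      refine ih ((hA.subset (Set.sep_subset _ _)).image _) ((hB.subset (Set.sep_subset _ _)).image _)
        hs (fun t ht => hr' t ?_) hs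
      rwa [← Set.image_union, ← Set.sep_union] at ht
    have htop : ConeFiltration r (upperClosure A : Set (Fin (n + 1) →₀ ℕ))
        (upperClosure A ∪ {a ∈ (upperClosure B : Set (Fin (n + 1) →₀ ℕ)) | d ≤ a 0}) := by
      convert ConeFiltration.stable_slice (upperClosure A).upper
        (hstab A Set.subset_union_left) (hslices d (r - 1) fun t ht => ?_) using 2
      · ext a
        simp only [Set.mem_ofPred_eq]
        refine ⟨fun h => ⟨h.2, hstab B Set.subset_union_right a h.1 h.2⟩, fun h => ⟨?_, h.1⟩⟩
        exact (upperClosure B).upper (le_of_tail_le (by simpa using h.1) (by simp)) h.2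
      · have := hr t (ht.of_image_tail.mono (Set.sep_subset _ _))
        omega
    -- Slices are added in decreasing order of the first coordinate, so that the intermediate sets
    -- are upper sets.
    have hdown : ∀ k ≤ d, ConeFiltration r (upperClosure A : Set (Fin (n + 1) →₀ ℕ))
        (upperClosure A ∪ {a ∈ (upperClosure B : Set (Fin (n + 1) →₀ ℕ)) | d - k ≤ a 0}) := by
      intro k hk
      induction k with
      | zero => exact htop
      | succ k ihk =>
        -- The generator `g` prolongs every chain of the slice, hence `r` need not be lowered.
        obtain ⟨g, hg, hjg⟩ := hdmax (d - (k + 1)) (by omega)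
        have hstep := ConeFiltration.slice (upperClosure A).upper (upperClosure B).upper
          (W := {a | Finsupp.cons (d - (k + 1)) a ∈ (upperClosure B : Set (Fin (n + 1) →₀ ℕ))})
          (fun a ha => ha) (hslices (d - (k + 1)) r fun t ht => by
            have := hr _ (ht.succ_of_tail hg hjg)
            omega)
        rw [show d - (k + 1) + 1 = d - k by omega] at hstep
        convert (ihk (by omega)).trans hstep using 1
        ext a
        simp only [Set.mem_union, Set.mem_ofPred_eq]
        constructor
        · rintro (h | ⟨h, h'⟩)
          · exact Or.inl (Or.inl h)
          · rcases h'.lt_or_eq with hlt | heq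
            · exact Or.inl (Or.inr ⟨h, by omega⟩)
            · exact Or.inr ⟨heq.symm, by rwa [cons_tail_of_eq heq.symm]⟩
        · rintro ((h | ⟨h, h'⟩) | ⟨h, h'⟩)
          · exact Or.inl h
          · exact Or.inr ⟨h, by omega⟩
          · rw [cons_tail_of_eq h] at h'
            exact Or.inr ⟨h', by omega⟩
    convert hdown d le_rfl using 1
    rw [Nat.sub_self]
    simp only [zero_le, and_true]
    exact (Set.union_eq_right.2 hsub').symm

end Filtration

/-! ### Stanley decompositions from cone filtrations -/

section Stanley

variable {σ K : Type*} [Field K]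

theorem mem_restrictSupportIdeal_iff {V : Set (σ →₀ ℕ)} {hV : IsUpperSet V}
    {p : MvPolynomial σ K} :
    p ∈ restrictSupportIdeal K V hV ↔ ∀ a, coeff a p ≠ 0 → a ∈ V :=
  ⟨fun h _ ha => h (mem_support_iff.2 ha), fun h a ha => h a (mem_support_iff.1 ha)⟩

theorem monomial_mem_restrictSupportIdeal {V : Set (σ →₀ ℕ)} {hV : IsUpperSet V}
    {a : σ →₀ ℕ} (ha : a ∈ V) : monomial a (1 : K) ∈ restrictSupportIdeal K V hV :=
  (monomial_mem_restrictSupport K).2 (Or.inl ha)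

/-- The class of the monomial `x^a ∈ I` in `I/J`, where the monomial ideal `I` is given by its set
of exponents. -/
noncomputable def monomialClass {V : Set (σ →₀ ℕ)} (hV : IsUpperSet V)
    (J : Ideal (MvPolynomial σ K)) {a : σ →₀ ℕ} (ha : a ∈ V) :
    IdealQuot (restrictSupportIdeal K V hV) J :=
  Submodule.Quotient.mk ⟨monomial a 1, monomial_mem_restrictSupportIdeal ha⟩

theorem idealQuot_mk_eq_zero {I J : Ideal (MvPolynomial σ K)} {p : I} :
    (Submodule.Quotient.mk p : IdealQuot I J) = 0 ↔ (p : MvPolynomial σ K) ∈ J := by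
  rw [Submodule.Quotient.mk_eq_zero]
  rfl

/-- The classes of the monomials of `I` span `I/J` over `K`. -/
theorem submodule_eq_top_of_monomialClass_mem {V : Set (σ →₀ ℕ)} {hV : IsUpperSet V}
    {J : Ideal (MvPolynomial σ K)}
    (N : Submodule K (IdealQuot (restrictSupportIdeal K V hV) J))
    (h : ∀ a (ha : a ∈ V), monomialClass hV J ha ∈ N) : N = ⊤ := by
  have hle : restrictSupport K V ≤
      (N.comap ((Submodule.mkQ _).restrictScalars K)).map
        ((Submodule.subtype (restrictSupportIdeal K V hV)).restrictScalars K) := by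
    rw [restrictSupport_eq_span, Submodule.span_le]
    rintro _ ⟨a, ha, rfl⟩
    exact ⟨⟨monomial a 1, monomial_mem_restrictSupportIdeal ha⟩, h a ha, rfl⟩
  rw [eq_top_iff]
  rintro x -
  obtain ⟨p, rfl⟩ := Submodule.Quotient.mk_surjective _ x
  obtain ⟨q, hq, hqp⟩ := hle p.2
  obtain rfl : q = p := Subtype.ext hqp
  exact hq

theorem monomialClass_eq_smul {V : Set (σ →₀ ℕ)} {hV : IsUpperSet V}
    {J : Ideal (MvPolynomial σ K)} {u a : σ →₀ ℕ} (hu : u ∈ V) (hua : u ≤ a) :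
    monomialClass hV J (hV hua hu) = monomial (a - u) (1 : K) • monomialClass hV J hu := by
  unfold monomialClass
  rw [← Submodule.Quotient.mk_smul]
  congr 1
  ext1
  simp [monomial_mul, tsub_add_cancel_of_le hua]

theorem mem_supported_iff_coeff {Z : Finset σ} {v : MvPolynomial σ K} :
    v ∈ supported K (Z : Set σ) ↔ ∀ a, coeff a v ≠ 0 → ∀ i ∉ Z, a i = 0 := by
  rw [mem_supported]
  constructor
  · intro h a ha i hi
    by_contra hai
    exact hi (h ((mem_vars_iff_mem_support i).2
      ⟨a, mem_support_iff.2 ha, Finsupp.mem_support_iff.2 hai⟩))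
  · intro h i hi
    obtain ⟨a, ha, hai⟩ := (mem_vars_iff_mem_support i).1 hi
    by_contra hiZ
    exact Finsupp.mem_support_iff.1 hai (h a (mem_support_iff.1 ha) i hiZ)

theorem mem_cone_of_coeff_mul_monomial {Z : Finset σ} {v : MvPolynomial σ K}
    (hv : v ∈ supported K (Z : Set σ)) {u a : σ →₀ ℕ} (ha : coeff a (v * monomial u 1) ≠ 0) :
    a ∈ cone u Z := by
  rw [coeff_mul_monomial', mul_one] at ha
  split_ifs at ha with hua
  · refine ⟨hua, fun i hi => ?_⟩
    have h1 := mem_supported_iff_coeff.1 hv _ ha i hi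
    have h2 := hua i
    rw [Finsupp.tsub_apply] at h1
    omega
  · exact (ha rfl).elim

theorem exists_mk_eq_of_mem_stanleySpace {V : Set (σ →₀ ℕ)} {hV : IsUpperSet V}
    {J : Ideal (MvPolynomial σ K)} {u : σ →₀ ℕ} {hu : u ∈ V} {Z : Finset σ}
    {m : IdealQuot (restrictSupportIdeal K V hV) J}
    (hm : m ∈ stanleySpace (K := K) (monomialClass hV J hu) Z) :
    ∃ p : restrictSupportIdeal K V hV, Submodule.Quotient.mk p = m ∧
      ∀ a, coeff a (p : MvPolynomial σ K) ≠ 0 → a ∈ cone u Z := by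
  obtain ⟨v, hv, hvm⟩ := Submodule.mem_map.1 hm
  have hv' : v ∈ supported K (Z : Set σ) := hv
  refine ⟨⟨v * monomial u 1, Ideal.mul_mem_left _ v (monomial_mem_restrictSupportIdeal hu)⟩, hvm,
    fun a ha => ?_⟩
  exact mem_cone_of_coeff_mul_monomial hv' ha

theorem self_mem_cone (u : σ →₀ ℕ) (Z : Finset σ) : u ∈ cone u Z :=
  ⟨le_rfl, fun _ _ => rfl⟩

theorem ConeFiltration.exists_partition {r : ℕ} {U V : Set (σ →₀ ℕ)}
    (h : ConeFiltration r U V) :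
    ∃ (m : ℕ) (u : Fin m → σ →₀ ℕ) (Z : Fin m → Finset σ), (∀ i, r ≤ (Z i).card) ∧
      V = U ∪ ⋃ i, cone (u i) (Z i) ∧ (∀ i, Disjoint U (cone (u i) (Z i))) ∧
      Pairwise fun i j => Disjoint (cone (u i) (Z i)) (cone (u j) (Z j)) := by
  induction h with
  | refl => exact ⟨0, Fin.elim0, Fin.elim0, fun i => i.elim0, by simp, fun i => i.elim0,
      fun i => i.elim0⟩
  | @step V V' v Y hf hr hd he hup ih =>
    obtain ⟨m, u, Z, hcard, hV, hU, hpair⟩ := ih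
    have hcone : ∀ i, Disjoint (cone (u i) (Z i)) (cone v Y) := fun i =>
      hd.mono_left (hV ▸ (Set.subset_iUnion (fun i => cone (u i) (Z i)) i).trans
        Set.subset_union_right)
    refine ⟨m + 1, Fin.cons v u, Fin.cons Y Z, ?_, ?_, ?_, ?_⟩
    · exact Fin.forall_fin_succ.2 ⟨hr, hcard⟩
    · rw [he, hV]
      ext a
      simp only [Set.mem_union, Set.mem_iUnion, Fin.exists_fin_succ, Fin.cons_zero, Fin.cons_succ]
      tauto
    · exact Fin.forall_fin_succ.2 ⟨hd.mono_left hf.subset, hU⟩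
    · intro i j
      refine Fin.cases ?_ (fun i => ?_) i <;> refine Fin.cases ?_ (fun j => ?_) j <;> intro hij
      · exact (hij rfl).elim
      · exact (hcone j).symm
      · exact hcone i
      · exact hpair fun h => hij (congrArg Fin.succ h)

/-- The cones of a cone filtration are the exponents of the Stanley spaces of a decomposition. -/
theorem ConeFiltration.le_sdepth {r : ℕ} {U V : Set (σ →₀ ℕ)} (h : ConeFiltration r U V)
    (hU : IsUpperSet U) (hV : IsUpperSet V) :
    (r : ℕ∞) ≤ sdepth σ (multigrading (restrictSupportIdeal K V hV)
      (restrictSupportIdeal K U hU)) := by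
  classical
  obtain ⟨m, u, Z, hcard, hVU, hUZ, hpair⟩ := h.exists_partition
  have huV : ∀ i, u i ∈ V := fun i =>
    hVU ▸ Or.inr (Set.mem_iUnion.2 ⟨i, self_mem_cone _ _⟩)
  let D : StanleyDecomposition (σ := σ) (multigrading (restrictSupportIdeal K V hV)
      (restrictSupportIdeal K U hU)) :=
    { size := m
      u := fun i => monomialClass hV _ (huV i)
      Z := Z
      homogeneous := fun i => ⟨u i, ⟨⟨monomial (u i) 1, monomial_mem_restrictSupportIdeal (huV i)⟩,
        Submodule.mem_span_singleton_self _, rfl⟩⟩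
      free := by
        intro i v hv h0
        have hmem : v * monomial (u i) 1 ∈ restrictSupportIdeal K U hU :=
          idealQuot_mk_eq_zero.1 h0
        have hz : v * monomial (u i) 1 = 0 := by
          ext a
          by_contra ha
          exact Set.disjoint_left.1 (hUZ i) (mem_restrictSupportIdeal_iff.1 hmem a ha)
            (mem_cone_of_coeff_mul_monomial hv ha)
        exact (mul_eq_zero.1 hz).resolve_right (by simp)
      isInternal := by
        refine DirectSum.isInternal_submodule_of_iSupIndep_of_iSup_eq_top ?_ ?_
        · rw [iSupIndep_iff_finsetSum_eq_zero_imp_eq_zero]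
          intro s v hv hsum j hj
          choose! p hpv hp using fun i hi => exists_mk_eq_of_mem_stanleySpace (hv i hi)
          have hmem : ((∑ i ∈ s, p i : restrictSupportIdeal K V hV) : MvPolynomial σ K) ∈
              restrictSupportIdeal K U hU := by
            rw [← idealQuot_mk_eq_zero, ← hsum, ← Submodule.mkQ_apply, map_sum]
            exact Finset.sum_congr rfl fun i hi => hpv i hi
          rw [← hpv j hj]
          suffices h : p j = 0 by rw [h]; rfl
          ext a
          by_contra ha
          -- The cones are disjoint, so only the `j`-th summand contains the monomial `x^a`.
          have hc : coeff a ((∑ i ∈ s, p i : restrictSupportIdeal K V hV) : MvPolynomial σ K)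
              = coeff a (p j : MvPolynomial σ K) := by
            rw [AddSubmonoidClass.coe_finsetSum, coeff_sum]
            refine Finset.sum_eq_single_of_mem j hj fun i hi hij => ?_
            by_contra hne
            exact Set.disjoint_left.1 (hpair hij) (hp i hi a hne) (hp j hj a ha)
          exact Set.disjoint_left.1 (hUZ j)
            (mem_restrictSupportIdeal_iff.1 hmem a (by rw [hc]; exact ha)) (hp j hj a ha)
        · refine submodule_eq_top_of_monomialClass_mem _ fun a ha => ?_
          have ha' := ha
          rw [hVU] at ha'
          rcases ha' with haU | haZ
          · have : monomialClass hV (restrictSupportIdeal K U hU) ha = 0 :=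
              idealQuot_mk_eq_zero.2 (monomial_mem_restrictSupportIdeal haU)
            rw [this]
            exact zero_mem _
          · obtain ⟨i, hi⟩ := Set.mem_iUnion.1 haZ
            refine Submodule.mem_iSup_of_mem i ⟨monomial (a - u i) 1, ?_,
              (monomialClass_eq_smul (huV i) hi.1).symm⟩
            refine mem_supported_iff_coeff.2 fun b hb k hk => ?_
            rw [coeff_monomial] at hb
            split_ifs at hb with hab
            · rw [← hab, Finsupp.tsub_apply, hi.2 k hk, tsub_self]
            · exact (hb rfl).elim }
  exact le_iSup_of_le D (le_iInf fun i => by exact_mod_cast hcard i)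

end Stanley

/-! ### Elementary symmetric polynomials as a common regular sequence -/

section Regular

section Exact

open RingTheory.Sequence

/-- Weakly regular sequences are inherited by extensions. -/
theorem isWeaklyRegular_of_exact {R : Type*} [CommRing R] {M M' M'' : Type*} [AddCommGroup M]
    [Module R M] [AddCommGroup M'] [Module R M'] [AddCommGroup M''] [Module R M'']
    {f : M →ₗ[R] M'} {g : M' →ₗ[R] M''} (hf : Function.Injective f) (hfg : Function.Exact f g)
    (hg : Function.Surjective g) {rs : List R} (h : IsWeaklyRegular M rs)
    (h'' : IsWeaklyRegular M'' rs) : IsWeaklyRegular M' rs := by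
  induction rs generalizing M M' M'' with
  | nil => exact .nil R M'
  | cons r rs ih =>
    rw [isWeaklyRegular_cons_iff] at h h'' ⊢
    refine ⟨isSMulRegular_of_range_eq_ker hf hfg.linearMap_ker_eq.symm h.1 h''.1,
      ih (f := QuotSMulTop.map r f) (g := QuotSMulTop.map r g) ?_
        (QuotSMulTop.map_exact r hfg hg) (QuotSMulTop.map_surjective r hg) h.2 h''.2⟩
    have h0 : Function.Exact (0 : M →ₗ[R] M) f := (LinearMap.exact_zero_iff_injective M f).2 hf
    have := QuotSMulTop.map_first_exact_on_four_term_exact_of_isSMulRegular_last h0 hfg h''.1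
    rw [map_zero] at this
    exact (LinearMap.exact_zero_iff_injective _ _).1 this

end Exact

variable {σ K : Type*} [Field K]

/-- The prime ideal generated by the variables outside `Z`, with quotient `K[Z]`. -/
noncomputable def coordinatePrime (K : Type*) [Field K] (Z : Finset σ) : Ideal (MvPolynomial σ K) :=
  Ideal.span (X '' {i | i ∉ Z})

theorem mem_coordinatePrime {Z : Finset σ} {p : MvPolynomial σ K} :
    p ∈ coordinatePrime K Z ↔ ∀ a, coeff a p ≠ 0 → ∃ i ∉ Z, a i ≠ 0 := by
  rw [coordinatePrime, mem_ideal_span_X_image]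
  simp only [mem_support_iff]
  rfl

theorem coordinatePrime_erase [DecidableEq σ] {Z : Finset σ} (x : σ) :
    coordinatePrime K (Z.erase x) = coordinatePrime K Z ⊔ Ideal.span {X x} := by
  rw [coordinatePrime, coordinatePrime, ← Ideal.span_union, ← Set.image_singleton,
    ← Set.image_union]
  congr 2
  ext i
  simp only [Set.mem_ofPred_eq, Finset.mem_erase, Set.mem_union, Set.mem_singleton_iff]
  tauto


theorem mem_coordinatePrime_of_X_mul_mem {Z : Finset σ} {x : σ} (hx : x ∈ Z)
    {p : MvPolynomial σ K} (h : X x * p ∈ coordinatePrime K Z) : p ∈ coordinatePrime K Z := by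
  classical
  rw [mem_coordinatePrime] at h ⊢
  intro a ha
  obtain ⟨i, hi, hai⟩ := h (Finsupp.single x 1 + a) (by rwa [coeff_X_mul])
  have hix : x ≠ i := fun h => hi (h ▸ hx)
  exact ⟨i, hi, by simpa [Finsupp.single_apply, hix] using hai⟩

variable [Fintype σ]

variable (σ K) in
/-- The sequence of the first `r` elementary symmetric polynomials of positive degree. -/
noncomputable def esymmList (r : ℕ) : List (MvPolynomial σ K) :=
  (List.range r).map fun i => esymm σ K (i + 1)

/-- The ideal whose residue ring is `K[Z]` modulo the first `i` elementary symmetric polynomials of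
positive degree. -/
noncomputable def esymmIdeal (K : Type*) [Field K] (Z : Finset σ) (i : ℕ) :
    Ideal (MvPolynomial σ K) :=
  coordinatePrime K Z ⊔ Ideal.ofList (esymmList σ K i)

theorem esymmIdeal_zero (Z : Finset σ) : esymmIdeal K Z 0 = coordinatePrime K Z := by
  simp [esymmIdeal, esymmList]

theorem esymmIdeal_succ (Z : Finset σ) (i : ℕ) :
    esymmIdeal K Z (i + 1) = esymmIdeal K Z i ⊔ Ideal.span {esymm σ K (i + 1)} := by
  simp [esymmIdeal, esymmList, List.range_succ, sup_assoc]

theorem esymmIdeal_erase [DecidableEq σ] {Z : Finset σ} (x : σ) (i : ℕ) :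
    esymmIdeal K (Z.erase x) i = esymmIdeal K Z i ⊔ Ideal.span {X x} := by
  rw [esymmIdeal, esymmIdeal, coordinatePrime_erase, sup_right_comm]

theorem esymm_isHomogeneous (i : ℕ) : (esymm σ K i).IsHomogeneous i := by
  refine IsHomogeneous.sum _ _ _ fun t ht => ?_
  have := IsHomogeneous.prod t (fun i => (X i : MvPolynomial σ K)) (fun _ => 1)
    fun i _ => isHomogeneous_X K i
  rwa [Finset.sum_const, smul_eq_mul, mul_one, (Finset.mem_powersetCard.1 ht).2] at this

theorem homogeneousComponent_mem_esymmIdeal (Z : Finset σ) (i d : ℕ) {p : MvPolynomial σ K}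
    (hp : p ∈ esymmIdeal K Z i) : homogeneousComponent d p ∈ esymmIdeal K Z i := by
  let _ : GradedAlgebra (homogeneousSubmodule σ K) := gradedAlgebra
  have hhom : (esymmIdeal K Z i).IsHomogeneous (homogeneousSubmodule σ K) := by
    refine Ideal.IsHomogeneous.sup (Ideal.homogeneous_span _ _ ?_) (Ideal.homogeneous_span _ _ ?_)
    · rintro _ ⟨j, -, rfl⟩
      exact ⟨1, isHomogeneous_X K j⟩
    · intro q hq
      obtain ⟨j, -, rfl⟩ := List.mem_map.1 hq
      exact ⟨j + 1, esymm_isHomogeneous _⟩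
  exact homogeneousComponent_mem_of_mem hhom hp d

/-- The powers of a variable intersect trivially modulo a homogeneous ideal, here `esymmIdeal K Z i`:
a homogeneous component of degree `d` has no contribution from multiples of `X x ^ (d + 1)`. -/
theorem mem_esymmIdeal_of_forall_pow {Z : Finset σ} {i : ℕ} {x : σ} {p : MvPolynomial σ K}
    (h : ∀ k, p ∈ esymmIdeal K Z i ⊔ Ideal.span {X x ^ k}) : p ∈ esymmIdeal K Z i := by
  rw [← sum_homogeneousComponent p]
  refine Ideal.sum_mem _ fun d _ => ?_
  obtain ⟨a, ha, b, hb, rfl⟩ := Submodule.mem_sup.1 (h (d + 1))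
  obtain ⟨q, rfl⟩ := Ideal.mem_span_singleton.1 hb
  have h0 : homogeneousComponent d (X x ^ (d + 1) * q) = 0 := by
    ext c
    rw [coeff_homogeneousComponent, coeff_zero]
    split_ifs with hc
    · rw [X_pow_eq_monomial, coeff_monomial_mul', if_neg]
      intro hle
      have h1 := Finsupp.degree_mono hle
      simp at h1
      omega
    · rfl
  rw [map_add, h0, add_zero]
  exact homogeneousComponent_mem_esymmIdeal _ _ _ ha

theorem esymm_sub_prod_mem_coordinatePrime (Z : Finset σ) :
    esymm σ K Z.card - ∏ i ∈ Z, X i ∈ coordinatePrime K Z := by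
  classical
  have hZ : Z ∈ Finset.powersetCard Z.card Finset.univ := by simp
  rw [esymm, ← Finset.sum_erase_add _ _ hZ, add_sub_cancel_right]
  refine Ideal.sum_mem _ fun t ht => ?_
  rw [Finset.mem_erase, Finset.mem_powersetCard] at ht
  obtain ⟨i, hit, hiZ⟩ : ∃ i ∈ t, i ∉ Z := by
    by_contra! hsub
    exact ht.1 (Finset.eq_of_subset_of_card_le hsub ht.2.2.ge)
  rw [← Finset.mul_prod_erase _ _ hit]
  exact Ideal.mul_mem_right _ _ (Ideal.subset_span ⟨i, hiZ, rfl⟩)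

theorem mem_esymmIdeal_of_prod_mul_mem {Z : Finset σ} {i : ℕ}
    (hX : ∀ x ∈ Z, ∀ p, X x * p ∈ esymmIdeal K Z i → p ∈ esymmIdeal K Z i) {Y : Finset σ}
    (hY : Y ⊆ Z) {p : MvPolynomial σ K} (h : (∏ x ∈ Y, X x) * p ∈ esymmIdeal K Z i) :
    p ∈ esymmIdeal K Z i := by
  classical
  induction Y using Finset.induction_on with
  | empty => simpa using h
  | insert x Y hx ih =>
    rw [Finset.prod_insert hx, mul_assoc] at h
    exact ih ((Finset.subset_insert _ _).trans hY)
      (hX x (hY (Finset.mem_insert_self _ _)) _ h)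

/-- Modulo the first `i` elementary symmetric polynomials of `K[Z]`, where `i < |Z|`, neither a
variable of `Z` nor the next elementary symmetric polynomial is a zero divisor. Both
are reduced to `Z` with one variable removed, and when `i + 1 = |Z|` the next elementary symmetric
polynomial is the product of the variables of `Z`. -/
theorem esymmIdeal_nonZeroDivisors (Z : Finset σ) (i : ℕ) (hi : i < Z.card) :
    (∀ x ∈ Z, ∀ p, X x * p ∈ esymmIdeal K Z i → p ∈ esymmIdeal K Z i) ∧
      ∀ p, esymm σ K (i + 1) * p ∈ esymmIdeal K Z i → p ∈ esymmIdeal K Z i := by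
  classical
  obtain ⟨c, hc⟩ : ∃ c, Z.card = c := ⟨_, rfl⟩
  induction c generalizing Z i with
  | zero => omega
  | succ c ihc =>
    have hcard : ∀ x ∈ Z, (Z.erase x).card = c := fun x hx => by
      rw [Finset.card_erase_of_mem hx, hc, Nat.add_sub_cancel]
    have hX : ∀ i < Z.card, ∀ x ∈ Z, ∀ p : MvPolynomial σ K,
        X x * p ∈ esymmIdeal K Z i → p ∈ esymmIdeal K Z i := by
      intro i hi x hx
      induction i with
      | zero =>
        intro p hp
        rw [esymmIdeal_zero] at hp ⊢
        exact mem_coordinatePrime_of_X_mul_mem hx hp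
      | succ i ih =>
        intro p hp
        rw [esymmIdeal_succ] at hp
        obtain ⟨a, ha, b, hb, hab⟩ := Submodule.mem_sup.1 hp
        obtain ⟨q, rfl⟩ := Ideal.mem_span_singleton.1 hb
        have hq : q ∈ esymmIdeal K (Z.erase x) i := by
          refine (ihc (Z.erase x) i (by rw [hcard x hx]; omega) (hcard x hx)).2 q ?_
          rw [esymmIdeal_erase, ← eq_sub_iff_add_eq'.2 hab |>.symm]
          exact sub_mem (Ideal.mul_mem_right _ _ (Ideal.mem_sup_right
            (Ideal.mem_span_singleton_self _))) (Ideal.mem_sup_left ha)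
        rw [esymmIdeal_erase] at hq
        obtain ⟨a', ha', b', hb', rfl⟩ := Submodule.mem_sup.1 hq
        obtain ⟨q', rfl⟩ := Ideal.mem_span_singleton.1 hb'
        have h1 : p - esymm σ K (i + 1) * q' ∈ esymmIdeal K Z i := by
          refine ih (by omega) _ ?_
          have : X x * (p - esymm σ K (i + 1) * q') = a + esymm σ K (i + 1) * a' := by
            linear_combination -hab
          rw [this]
          exact add_mem ha (Ideal.mul_mem_left _ _ ha')
        rw [esymmIdeal_succ, ← sub_add_cancel p (esymm σ K (i + 1) * q')]
        exact add_mem (Ideal.mem_sup_left h1) (Ideal.mem_sup_right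
          (Ideal.mul_mem_right _ _ (Ideal.mem_span_singleton_self _)))
    refine ⟨hX i hi, fun p hp => ?_⟩
    -- The case `i + 1 = |Z|` is that of a product of variables. Otherwise `p` is divisible by every
    -- power of a variable `x ∈ Z`, as `esymm (i + 1)` is not a zero divisor modulo `x`.
    rcases (Nat.succ_le_of_lt hi).eq_or_lt with heq | hlt
    · refine mem_esymmIdeal_of_prod_mul_mem (hX i hi) subset_rfl ?_
      have h1 : (esymm σ K (i + 1) - ∏ x ∈ Z, X x) * p ∈ esymmIdeal K Z i := by
        refine Ideal.mul_mem_right _ _ (Ideal.mem_sup_left ?_)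
        rw [← Nat.succ_eq_add_one, heq]
        exact esymm_sub_prod_mem_coordinatePrime Z
      have := sub_mem hp h1
      rwa [← sub_mul, sub_sub_cancel] at this
    · obtain ⟨x, hx⟩ : Z.Nonempty := Finset.card_pos.1 (by omega)
      refine mem_esymmIdeal_of_forall_pow (x := x) fun k => ?_
      induction k generalizing p with
      | zero => simp
      | succ k ihk =>
        have hpx : p ∈ esymmIdeal K (Z.erase x) i := by
          refine (ihc (Z.erase x) i (by rw [hcard x hx]; omega) (hcard x hx)).2 p ?_
          rw [esymmIdeal_erase]
          exact Ideal.mem_sup_left hp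
        rw [esymmIdeal_erase] at hpx
        obtain ⟨a, ha, b, hb, rfl⟩ := Submodule.mem_sup.1 hpx
        obtain ⟨q, rfl⟩ := Ideal.mem_span_singleton.1 hb
        have hq : esymm σ K (i + 1) * q ∈ esymmIdeal K Z i := by
          refine hX i hi x hx _ ?_
          have := sub_mem hp (Ideal.mul_mem_left _ (esymm σ K (i + 1)) ha)
          rwa [← mul_sub, add_sub_cancel_left, mul_left_comm] at this
        obtain ⟨a', ha', b', hb', rfl⟩ := Submodule.mem_sup.1 (ihk q hq)
        obtain ⟨q', rfl⟩ := Ideal.mem_span_singleton.1 hb'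
        rw [mul_add, ← add_assoc, ← mul_assoc, ← pow_succ']
        exact add_mem (Ideal.mem_sup_left (add_mem ha (Ideal.mul_mem_left _ _ ha')))
          (Ideal.mem_sup_right (Ideal.mul_mem_right _ _ (Ideal.mem_span_singleton_self _)))

theorem take_esymmList {r i : ℕ} (hi : i ≤ r) :
    (esymmList σ K r).take i = esymmList σ K i := by
  rw [esymmList, esymmList, ← List.map_take, List.take_range, min_eq_left hi]

/-- The first `r` elementary symmetric polynomials in all variables form a weakly regular
sequence on every `K[Z]` with `r ≤ |Z|`. -/
theorem isWeaklyRegular_coordinatePrime {Z : Finset σ} {r : ℕ} (hr : r ≤ Z.card) :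
    RingTheory.Sequence.IsWeaklyRegular (MvPolynomial σ K ⧸ coordinatePrime K Z)
      (esymmList σ K r) := by
  refine ⟨fun i hi => ?_⟩
  have hir : i < r := by simpa [esymmList] using hi
  rw [isSMulRegular_quotient_iff_mem_of_smul_mem, take_esymmList hir.le]
  have hmem : ∀ p : MvPolynomial σ K, (Ideal.Quotient.mk (coordinatePrime K Z) p) ∈
      (Ideal.ofList (esymmList σ K i) • ⊤ :
        Submodule (MvPolynomial σ K) (MvPolynomial σ K ⧸ coordinatePrime K Z)) ↔
        p ∈ esymmIdeal K Z i := by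
    intro p
    rw [Ideal.smul_top_eq_map, Submodule.restrictScalars_mem, Ideal.Quotient.algebraMap_eq,
      Ideal.mem_quotient_iff_mem_sup, sup_comm, esymmIdeal]
  intro y hy
  obtain ⟨p, rfl⟩ := Ideal.Quotient.mk_surjective y
  rw [hmem]
  refine (esymmIdeal_nonZeroDivisors Z i (hir.trans_le hr)).2 p ((hmem _).1 ?_)
  convert hy using 1
  simp only [esymmList, List.getElem_map, List.getElem_range]
  rfl

end Regular

/-! ### Depth from cone filtrations -/

section Depth

variable {σ K : Type*} [Field K]

/-- If `u + ℕ^Z` is adjoined to the exponents of a monomial ideal, the quotient of the new ideal by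
the old one is generated by the class of `x^u` and isomorphic to `K[Z]`. -/
theorem isWeaklyRegular_adjoin_cone [Fintype σ] {r : ℕ} {V V' : Set (σ →₀ ℕ)}
    (hV : IsUpperSet V) (hV' : IsUpperSet V') {u : σ →₀ ℕ} {Z : Finset σ} (hr : r ≤ Z.card)
    (hd : Disjoint V (cone u Z)) (he : V' = V ∪ cone u Z) :
    RingTheory.Sequence.IsWeaklyRegular
      (IdealQuot (restrictSupportIdeal K V' hV') (restrictSupportIdeal K V hV))
      (esymmList σ K r) := by
  have hu : u ∈ V' := he ▸ Or.inr (self_mem_cone u Z)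
  let φ := LinearMap.toSpanSingleton (MvPolynomial σ K)
    (IdealQuot (restrictSupportIdeal K V' hV') (restrictSupportIdeal K V hV))
    (monomialClass hV' _ hu)
  have hker : LinearMap.ker φ = coordinatePrime K Z := by
    ext p
    have h1 : p ∈ LinearMap.ker φ ↔ p * monomial u 1 ∈ restrictSupportIdeal K V hV := by
      rw [LinearMap.mem_ker, ← idealQuot_mk_eq_zero (I := restrictSupportIdeal K V' hV')
        (p := ⟨p * monomial u 1, Ideal.mul_mem_left _ p (monomial_mem_restrictSupportIdeal hu)⟩)]
      rfl
    rw [h1, mem_restrictSupportIdeal_iff, mem_coordinatePrime]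
    constructor
    · intro h a ha
      by_contra! hZ
      refine Set.disjoint_left.1 hd (h (a + u) (by rwa [coeff_mul_monomial, mul_one])) ⟨?_, ?_⟩
      · exact le_add_self
      · intro i hi
        rw [Finsupp.add_apply, hZ i hi, zero_add]
    · intro h a ha
      rw [coeff_mul_monomial', mul_one] at ha
      split_ifs at ha with hua
      · obtain ⟨i, hi, hai⟩ := h _ ha
        have haV' : a ∈ V ∪ cone u Z := he ▸ hV' hua hu
        refine haV'.resolve_right fun hc => hai ?_
        rw [Finsupp.tsub_apply, hc.2 i hi, tsub_self]
      · exact (ha rfl).elim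
  have hsurj : Function.Surjective φ := by
    have := submodule_eq_top_of_monomialClass_mem ((LinearMap.range φ).restrictScalars K) ?_
    · rw [← LinearMap.range_eq_top]
      exact (Submodule.restrictScalars_eq_top_iff K _ _).1 this
    · intro a ha
      have ha' : a ∈ V ∪ cone u Z := he ▸ ha
      rcases ha' with haV | haZ
      · have : monomialClass hV' (restrictSupportIdeal K V hV) ha = 0 :=
          idealQuot_mk_eq_zero.2 (monomial_mem_restrictSupportIdeal haV)
        rw [this]
        exact zero_mem _
      · exact ⟨monomial (a - u) 1, (monomialClass_eq_smul hu haZ.1).symm⟩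
  have e := (Submodule.quotEquivOfEq _ _ hker).symm.trans (φ.quotKerEquivOfSurjective hsurj)
  exact (e.isWeaklyRegular_congr _).1 (isWeaklyRegular_coordinatePrime hr)

theorem isWeaklyRegular_of_subsingleton {R M : Type*} [CommRing R] [AddCommGroup M] [Module R M]
    [Subsingleton M] (rs : List R) : RingTheory.Sequence.IsWeaklyRegular M rs :=
  ⟨fun _ _ => Function.injective_of_subsingleton _⟩

/-- Weak regularity passes from the two successive quotients of `J ⊆ L ⊆ I` to `I/J`. -/
theorem isWeaklyRegular_idealQuot_trans {I L J : Ideal (MvPolynomial σ K)} (hJL : J ≤ L)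
    (hLI : L ≤ I) {rs : List (MvPolynomial σ K)}
    (h₁ : RingTheory.Sequence.IsWeaklyRegular (IdealQuot L J) rs)
    (h₂ : RingTheory.Sequence.IsWeaklyRegular (IdealQuot I L) rs) :
    RingTheory.Sequence.IsWeaklyRegular (IdealQuot I J) rs := by
  let f : IdealQuot L J →ₗ[MvPolynomial σ K] IdealQuot I J :=
    Submodule.mapQ _ _ (Submodule.inclusion hLI) fun _ hx => hx
  let g : IdealQuot I J →ₗ[MvPolynomial σ K] IdealQuot I L :=
    Submodule.mapQ _ _ LinearMap.id fun _ hx => hJL hx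
  refine isWeaklyRegular_of_exact (f := f) (g := g) ?_ ?_ ?_ h₁ h₂
  · rw [injective_iff_map_eq_zero]
    intro x hx
    obtain ⟨p, rfl⟩ := Submodule.Quotient.mk_surjective _ x
    have hx' : (Submodule.Quotient.mk (Submodule.inclusion hLI p) : IdealQuot I J) = 0 := hx
    exact idealQuot_mk_eq_zero.2
      ((idealQuot_mk_eq_zero (p := Submodule.inclusion hLI p)).1 hx')
  · intro x
    obtain ⟨p, rfl⟩ := Submodule.Quotient.mk_surjective _ x
    constructor
    · intro hx
      exact ⟨Submodule.Quotient.mk ⟨p, idealQuot_mk_eq_zero.1 hx⟩, rfl⟩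
    · rintro ⟨y, hy⟩
      obtain ⟨q, rfl⟩ := Submodule.Quotient.mk_surjective _ y
      rw [← hy]
      exact idealQuot_mk_eq_zero.2 q.2
  · intro x
    obtain ⟨p, rfl⟩ := Submodule.Quotient.mk_surjective _ x
    exact ⟨Submodule.Quotient.mk p, rfl⟩

theorem restrictSupportIdeal_mono {U V : Set (σ →₀ ℕ)} (hU : IsUpperSet U) (hV : IsUpperSet V)
    (h : U ⊆ V) : restrictSupportIdeal K U hU ≤ restrictSupportIdeal K V hV :=
  fun _ hp => mem_restrictSupportIdeal_iff.2 fun a ha => h (mem_restrictSupportIdeal_iff.1 hp a ha)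

theorem ConeFiltration.isWeaklyRegular [Fintype σ] {r : ℕ} {U V : Set (σ →₀ ℕ)}
    (h : ConeFiltration r U V) (hU : IsUpperSet U) (hV : IsUpperSet V) :
    RingTheory.Sequence.IsWeaklyRegular
      (IdealQuot (restrictSupportIdeal K V hV) (restrictSupportIdeal K U hU))
      (esymmList σ K r) := by
  induction h with
  | refl =>
    have : Subsingleton (IdealQuot (restrictSupportIdeal K U hV) (restrictSupportIdeal K U hU)) :=
      Submodule.Quotient.subsingleton_iff.2 (Submodule.submoduleOf_self _)
    exact isWeaklyRegular_of_subsingleton _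
  | @step V V' u Z hf hr hd he hup ih =>
    have hV₀ := hf.isUpperSet hU
    exact isWeaklyRegular_idealQuot_trans (restrictSupportIdeal_mono hU hV₀ hf.subset)
      (restrictSupportIdeal_mono hV₀ hV (he ▸ Set.subset_union_left)) (ih hV₀)
      (isWeaklyRegular_adjoin_cone hV₀ hV hr hd he)

theorem mem_span_X_of_mem_esymmList [Fintype σ] {r : ℕ} {q : MvPolynomial σ K}
    (hq : q ∈ esymmList σ K r) : q ∈ Ideal.span (Set.range (X : σ → MvPolynomial σ K)) := by
  classical
  obtain ⟨i, -, rfl⟩ := List.mem_map.1 hq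
  refine Ideal.sum_mem _ fun t ht => ?_
  obtain ⟨x, hx⟩ : t.Nonempty := Finset.card_pos.1 (by
    rw [(Finset.mem_powersetCard.1 ht).2]; omega)
  rw [← Finset.mul_prod_erase _ _ hx]
  exact Ideal.mul_mem_right _ _ (Ideal.subset_span ⟨x, rfl⟩)

/-- Nakayama's lemma for quotients of monomial ideals: a minimal generator of `I` outside `J`
does not lie in `(x_i : i ∈ σ) I + J`. -/
theorem top_ne_smul_top {U V : Set (σ →₀ ℕ)} (hU : IsUpperSet U) (hV : IsUpperSet V)
    (hUV : U ⊂ V) {𝔞 : Ideal (MvPolynomial σ K)}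
    (h𝔞 : 𝔞 ≤ Ideal.span (Set.range (X : σ → MvPolynomial σ K))) :
    (⊤ : Submodule (MvPolynomial σ K)
      (IdealQuot (restrictSupportIdeal K V hV) (restrictSupportIdeal K U hU))) ≠ 𝔞 • ⊤ := by
  classical
  obtain ⟨b, hbV, hbU⟩ := Set.exists_of_ssubset hUV
  obtain ⟨a, hab, ha⟩ := exists_minimal_le_of_wellFoundedLT (· ∈ V) b hbV
  have haU : a ∉ U := fun h => hbU (hU hab h)
  -- Removing the minimal exponent `a` leaves a monomial ideal containing `(x_i : i ∈ σ) I + J`.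
  have hW : IsUpperSet (V \ {a}) := by
    rintro c d hcd ⟨hcV, hca⟩
    refine ⟨hV hcd hcV, fun hda => hca ?_⟩
    obtain rfl : d = a := hda
    exact le_antisymm hcd (ha.2 hcV hcd)
  have hle : 𝔞 • (⊤ : Submodule (MvPolynomial σ K)
      (IdealQuot (restrictSupportIdeal K V hV) (restrictSupportIdeal K U hU))) ≤
      ((restrictSupportIdeal K (V \ {a}) hW).submoduleOf (restrictSupportIdeal K V hV)).map
        (Submodule.mkQ _) := by
    refine Submodule.smul_le.2 fun q hq x _ => ?_
    obtain ⟨p, rfl⟩ := Submodule.Quotient.mk_surjective _ x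
    suffices hqp : q * (p : MvPolynomial σ K) ∈ restrictSupportIdeal K (V \ {a}) hW by
      exact ⟨⟨q * p, Ideal.mul_mem_left _ q p.2⟩, hqp, rfl⟩
    rw [mem_restrictSupportIdeal_iff]
    refine fun c hc => ⟨mem_restrictSupportIdeal_iff.1 (Ideal.mul_mem_left _ q p.2) c hc, ?_⟩
    rintro rfl
    rw [coeff_mul] at hc
    obtain ⟨⟨s, t⟩, hst, hne⟩ := Finset.exists_ne_zero_of_sum_ne_zero hc
    rw [Finset.HasAntidiagonal.mem_antidiagonal] at hst
    have htV : t ∈ V := mem_restrictSupportIdeal_iff.1 p.2 t (right_ne_zero_of_mul hne)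
    have htc : t = c := le_antisymm (hst ▸ le_add_self) (ha.2 htV (hst ▸ le_add_self))
    have hs : s = 0 := by simpa [htc] using hst
    have hq' := h𝔞 hq
    rw [← Set.image_univ, mem_ideal_span_X_image] at hq'
    obtain ⟨i, -, hi⟩ := hq' s (mem_support_iff.2 (left_ne_zero_of_mul hne))
    exact hi (by rw [hs]; rfl)
  intro htop
  have haV : a ∈ V := ha.1
  have hmem := hle (htop ▸ Submodule.mem_top :
    monomialClass hV (restrictSupportIdeal K U hU) haV ∈ _)
  rw [Submodule.mem_map] at hmem
  obtain ⟨p, hp, hpa⟩ := hmem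
  have hsub : (p : MvPolynomial σ K) - monomial a 1 ∈ restrictSupportIdeal K U hU := by
    rw [monomialClass, Submodule.mkQ_apply, Submodule.Quotient.eq] at hpa
    exact hpa
  have hmon : monomial a (1 : K) ∈ restrictSupportIdeal K (V \ {a}) hW := by
    have h1 := restrictSupportIdeal_mono (K := K) hU hW
      (fun c hc => ⟨hUV.1 hc, fun hca => haU (hca ▸ hc)⟩) hsub
    have h2 : (p : MvPolynomial σ K) ∈ restrictSupportIdeal K (V \ {a}) hW := hp
    simpa using sub_mem h2 h1
  exact (mem_restrictSupportIdeal_iff.1 hmon a (by simp)).2 rfl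

/-- The cones of a cone filtration bound the depth from below, as the elementary symmetric
polynomials form a regular sequence on the quotient. -/
theorem ConeFiltration.le_depth [Fintype σ] {r : ℕ} {U V : Set (σ →₀ ℕ)}
    (h : ConeFiltration r U V) (hU : IsUpperSet U) (hV : IsUpperSet V) (hUV : U ⊂ V) :
    (r : ℕ∞) ≤ depth (σ := σ) (K := K)
      (IdealQuot (restrictSupportIdeal K V hV) (restrictSupportIdeal K U hU)) := by
  have hmem : esymmList σ K r ∈ {rs : List (MvPolynomial σ K) |
      RingTheory.Sequence.IsRegular
        (IdealQuot (restrictSupportIdeal K V hV) (restrictSupportIdeal K U hU)) rs ∧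
      ∀ q ∈ rs, q ∈ Ideal.span (Set.range (X : σ → MvPolynomial σ K))} := by
    refine ⟨⟨h.isWeaklyRegular hU hV, top_ne_smul_top hU hV hUV ?_⟩,
      fun q hq => mem_span_X_of_mem_esymmList hq⟩
    exact Ideal.span_le.2 fun q hq => mem_span_X_of_mem_esymmList hq
  refine le_trans ?_ (le_iSup₂_of_le _ hmem le_rfl)
  simp [esymmList]

theorem eq_restrictSupportIdeal {I : Ideal (MvPolynomial σ K)} (hI : IsMonomialIdeal I) :
    I = restrictSupportIdeal K (upperClosure (minGens I)) (upperClosure (minGens I)).upper := by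
  conv_lhs => rw [← span_minGens hI]
  ext p
  rw [mem_ideal_span_monomial_image, mem_restrictSupportIdeal_iff]
  simp only [mem_support_iff]
  rfl

theorem HasLcmChain.le_lcmNumber [Finite σ] {I J : Ideal (MvPolynomial σ K)} {t : ℕ}
    (h : HasLcmChain (minGens I ∪ minGens J) t) : t ≤ lcmNumber I J :=
  le_csSup (bddAbove_hasLcmChain I J) h

end Depth

end MonomialLcm

theorem mainTheorem1 {K : Type*} [Field K] (n : ℕ)
    (I J : Ideal (MvPolynomial (Fin n) K))
    (hI : MonomialLcm.IsMonomialIdeal I) (hJ : MonomialLcm.IsMonomialIdeal J) (hJI : J < I) :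
    (n : ℕ∞) + 1 ≤
        MonomialLcm.depth (σ := Fin n) (K := K) (MonomialLcm.IdealQuot I J)
          + (MonomialLcm.lcmNumber I J : ℕ∞) ∧
      (n : ℕ∞) + 1 ≤
        MonomialLcm.sdepth (Fin n) (MonomialLcm.multigrading I J)
          + (MonomialLcm.lcmNumber I J : ℕ∞) := by
  obtain ⟨l, hl⟩ : ∃ l, MonomialLcm.lcmNumber I J = l := ⟨_, rfl⟩
  have hchain : ∀ t, MonomialLcm.HasLcmChain
      (MonomialLcm.minGens J ∪ MonomialLcm.minGens I) t → n + 1 - l ≤ n + 1 - t := by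
    intro t ht
    rw [Set.union_comm] at ht
    have := ht.le_lcmNumber
    omega
  have hfinI := MonomialLcm.finite_minGens I
  have hfinJ := MonomialLcm.finite_minGens J
  have hI' := MonomialLcm.eq_restrictSupportIdeal hI
  have hJ' := MonomialLcm.eq_restrictSupportIdeal hJ
  rw [hl]
  generalize MonomialLcm.minGens I = B at *
  generalize MonomialLcm.minGens J = A at *
  subst hI' hJ'
  have hss : (upperClosure A : Set (Fin n →₀ ℕ)) ⊂ upperClosure B := by
    refine ⟨fun a ha => ?_, fun hle =>
      hJI.not_ge (MonomialLcm.restrictSupportIdeal_mono _ _ hle)⟩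
    exact MonomialLcm.mem_restrictSupportIdeal_iff.1
      (hJI.le (MonomialLcm.monomial_mem_restrictSupportIdeal ha)) a (by simp)
  have hF := MonomialLcm.exists_coneFiltration hfinJ hfinI hss.1 hchain
  have key : ∀ x : ℕ∞, ((n + 1 - l : ℕ) : ℕ∞) ≤ x → (n : ℕ∞) + 1 ≤ x + l := by
    intro x hx
    calc (n : ℕ∞) + 1 = ((n + 1 : ℕ) : ℕ∞) := by push_cast; rfl
      _ ≤ ((n + 1 - l + l : ℕ) : ℕ∞) := by exact_mod_cast (by omega)
      _ ≤ x + l := by push_cast at hx ⊢; gcongr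
  exact ⟨key _ (hF.le_depth _ _ hss), key _ (hF.le_sdepth _ _)⟩
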